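/- Let $G$ be the complex Lie group of unipotent matrices $\begin{pmatrix}1&x&y\\0&1&z\\0&0&1\end{pmatrix}$ with $x,y,z\in\mathbb C$; its centre is $Z(G)=\{x=z=0\}\cong\mathbb C$ and its abelianization is $p\colon G\to G/Z(G)=\mathbb C^2$, $(x,y,z)\mapsto(x,z)$. Let $I$ be an Iwasawa manifold, that is, a compact complex manifold with a transitive holomorphic action of $G$ with discrete stabilizers. Choose a point $o\in I$, let $\Lambda\subset G$ be its stabilizer, so that $I\cong G/\Lambda$, and put $\Gamma=\Lambda\cap Z(G)\subset\mathbb C$ and $\Delta=p(\Lambda)\subset\mathbb C^2$. The map $p$ induces the Iwasawa bundle $\pi\colon I\to T=\mathbb C^2/\Delta$, whose structure group and fibre is $E=\mathbb C/\Gamma$. Then $\Gamma$ and $\Delta$ are lattices of full rank in $\mathbb C$ and $\mathbb C^2$ (so $E$ is an elliptic curve and $T$ is a complex torus of dimension $2$), and there are elliptic curves $E'$ and $E''$ such that $T$ is isogenous to $E'\times E''$, that is, there is a surjective holomorphic homomorphism $T\to E'\times E''$ with finite kernel. Moreover the three curves $E$, $E'$ and $E''$ have complex multiplication by the same imaginary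 quadratic field: there is an imaginary quadratic field $K$ such that the $\mathbb Q$-algebras $\operatorname{End}(E)\otimes\mathbb Q$, $\operatorname{End}(E')\otimes\mathbb Q$ and $\operatorname{End}(E'')\otimes\mathbb Q$ are all isomorphic to $K$. -/

import Mathlib

open scoped Manifold ContDiff Topology TensorProduct

namespace Iwasawa

/-! ## The group of complex unipotent `3 × 3` matrices -/

/-- The group `G` of matrices with rows `(1, x, y)`, `(0, 1, z)`, `(0, 0, 1)`, where `x`, `y`, `z`
are complex numbers, in its global coordinates `x`, `y`, `z`. -/
@[ext]
structure G where
  x : ℂ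
  y : ℂ
  z : ℂ

namespace G

/-- The unipotent matrix with the given coordinates. -/
def toMatrix (g : G) : Matrix (Fin 3) (Fin 3) ℂ :=
  !![1, g.x, g.y; 0, 1, g.z; 0, 0, 1]

instance : Mul G := ⟨fun g h => ⟨g.x + h.x, g.y + h.y + g.x * h.z, g.z + h.z⟩⟩

instance : One G := ⟨⟨0, 0, 0⟩⟩

instance : Inv G := ⟨fun g => ⟨-g.x, -g.y + g.x * g.z, -g.z⟩⟩

@[simp] theorem mul_x (g h : G) : (g * h).x = g.x + h.x := rfl
@[simp] theorem mul_y (g h : G) : (g * h).y = g.y + h.y + g.x * h.z := rfl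
@[simp] theorem mul_z (g h : G) : (g * h).z = g.z + h.z := rfl
@[simp] theorem one_x : (1 : G).x = 0 := rfl
@[simp] theorem one_y : (1 : G).y = 0 := rfl
@[simp] theorem one_z : (1 : G).z = 0 := rfl
@[simp] theorem inv_x (g : G) : (g⁻¹).x = -g.x := rfl
@[simp] theorem inv_y (g : G) : (g⁻¹).y = -g.y + g.x * g.z := rfl
@[simp] theorem inv_z (g : G) : (g⁻¹).z = -g.z := rfl

instance : Group G :=
  Group.ofLeftAxioms
    (fun a b c => by ext <;> simp <;> ring)
    (fun a => by ext <;> simp)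
    (fun a => by ext <;> simp)

/-- The group law is matrix multiplication. -/
theorem toMatrix_mul (g h : G) : (g * h).toMatrix = g.toMatrix * h.toMatrix := by
  ext i j
  fin_cases i <;> fin_cases j <;>
    simp [toMatrix, Matrix.mul_apply, Fin.sum_univ_three] <;> ring

/-- The topology of `G` is that of its coordinates in `ℂ³`. -/
noncomputable instance : TopologicalSpace G :=
  TopologicalSpace.induced (fun g : G => (g.x, g.y, g.z)) inferInstance

/-- The projection `p : G → G/Z(G) = G^ab = ℂ²`. -/
noncomputable def ab : G →* Multiplicative (ℂ × ℂ) where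
  toFun g := Multiplicative.ofAdd (g.x, g.z)
  map_one' := rfl
  map_mul' _ _ := rfl

/-- The inclusion `ℂ = Z(G) → G` of the centre. -/
noncomputable def central : Multiplicative ℂ →* G where
  toFun w := ⟨0, w.toAdd, 0⟩
  map_one' := rfl
  map_mul' _ _ := by ext <;> simp

/-- The image of `central` is the centre of `G`. -/
theorem range_central : central.range = Subgroup.center G := by
  ext g
  rw [Subgroup.mem_center_iff]
  constructor
  · rintro ⟨w, rfl⟩ h
    ext <;> simp [central, add_comm]
  · intro hg
    have h1 := congrArg G.y (hg ⟨1, 0, 0⟩)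
    have h2 := congrArg G.y (hg ⟨0, 0, 1⟩)
    simp only [mul_y, mul_zero, add_zero, zero_add, one_mul, mul_one, zero_mul] at h1 h2
    refine ⟨Multiplicative.ofAdd g.y, ?_⟩
    ext
    · change (0 : ℂ) = g.x
      linear_combination h2
    · rfl
    · change (0 : ℂ) = g.z
      linear_combination -h1

/-- The kernel of `ab` is the commutator subgroup of `G`, so that `ab` is the abelianization. -/
theorem ker_ab : ab.ker = commutator G := by
  apply le_antisymm
  · intro g hg
    have h0 : ((g.x, g.z) : ℂ × ℂ) = 0 := hg
    have hx : g.x = 0 := congrArg Prod.fst h0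
    have hz : g.z = 0 := congrArg Prod.snd h0
    have h : g = (⟨g.y, 0, 0⟩ : G) * ⟨0, 0, 1⟩ * (⟨g.y, 0, 0⟩ : G)⁻¹ * (⟨0, 0, 1⟩ : G)⁻¹ := by
      ext <;> simp [hx, hz]
    rw [h, ← commutatorElement_def]
    exact Subgroup.commutator_mem_commutator (Subgroup.mem_top _) (Subgroup.mem_top _)
  · exact Abelianization.commutator_subset_ker ab

/-- The kernel of `ab` is the centre of `G`. -/
theorem ker_ab_eq_center : ab.ker = Subgroup.center G := by
  rw [← range_central]
  ext g
  constructor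
  · intro hg
    have h0 : ((g.x, g.z) : ℂ × ℂ) = 0 := hg
    refine ⟨Multiplicative.ofAdd g.y, ?_⟩
    ext
    · exact (congrArg Prod.fst h0).symm
    · rfl
    · exact (congrArg Prod.snd h0).symm
  · rintro ⟨w, rfl⟩
    rfl

end G

/-! ## Complex tori, their homomorphisms and complex multiplication -/

section Tori

/-- A lattice of full rank in a complex vector space `V`: a discrete subgroup that spans `V`
over `ℝ`. The quotient `V ⧸ L` is then a complex torus, an elliptic curve when `V = ℂ`. -/
def IsLattice {V : Type*} [NormedAddCommGroup V] [NormedSpace ℂ V] (L : AddSubgroup V) : Prop :=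
  DiscreteTopology L ∧ Submodule.span ℝ (L : Set V) = ⊤

/-- A map `V ⧸ L → W ⧸ M` is holomorphic for the quotient complex structures: near every point it
is given by a holomorphic map `V → W` of the universal covers. -/
def IsHolomorphic {V W : Type*} [NormedAddCommGroup V] [NormedSpace ℂ V] [NormedAddCommGroup W]
    [NormedSpace ℂ W] {L : AddSubgroup V} {M : AddSubgroup W} (f : V ⧸ L → W ⧸ M) : Prop :=
  ∀ v : V, ∃ F : V → W, AnalyticAt ℂ F v ∧
    ∀ᶠ u in 𝓝 v, f (QuotientAddGroup.mk u) = QuotientAddGroup.mk (F u)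

/-- An isogeny of complex tori: a surjective holomorphic homomorphism with finite kernel. -/
def IsIsogeny {V W : Type*} [NormedAddCommGroup V] [NormedSpace ℂ V] [NormedAddCommGroup W]
    [NormedSpace ℂ W] {L : AddSubgroup V} {M : AddSubgroup W} (f : V ⧸ L →+ W ⧸ M) : Prop :=
  IsHolomorphic f ∧ Function.Surjective f ∧ (f.ker : Set (V ⧸ L)).Finite

/-- The complex tori `V ⧸ L` and `W ⧸ M` are isogenous. -/
def Isogenous {V W : Type*} [NormedAddCommGroup V] [NormedSpace ℂ V] [NormedAddCommGroup W]
    [NormedSpace ℂ W] (L : AddSubgroup V) (M : AddSubgroup W) : Prop :=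
  ∃ f : V ⧸ L →+ W ⧸ M, IsIsogeny f

/-- The endomorphism ring of the complex torus `V ⧸ L`: its holomorphic group endomorphisms. -/
def endRing {V : Type*} [NormedAddCommGroup V] [NormedSpace ℂ V] (L : AddSubgroup V) :
    Subring (AddMonoid.End (V ⧸ L)) where
  carrier := {f | IsHolomorphic f}
  one_mem' v := ⟨id, analyticAt_id, Filter.Eventually.of_forall fun _ => rfl⟩
  zero_mem' v := ⟨fun _ => 0, analyticAt_const, Filter.Eventually.of_forall fun _ => rfl⟩
  mul_mem' {f g} hf hg v := by
    obtain ⟨b, hb, hb'⟩ := hg v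
    obtain ⟨a, ha, ha'⟩ := hf (b v)
    refine ⟨a ∘ b, ha.comp hb, ?_⟩
    filter_upwards [hb', hb.continuousAt.eventually ha'] with u h1 h2
    change f (g (QuotientAddGroup.mk u)) = _
    rw [h1, h2]
    rfl
  add_mem' {f g} hf hg v := by
    obtain ⟨a, ha, ha'⟩ := hf v
    obtain ⟨b, hb, hb'⟩ := hg v
    refine ⟨a + b, ha.add hb, ?_⟩
    filter_upwards [ha', hb'] with u h1 h2
    change f (QuotientAddGroup.mk u) + g (QuotientAddGroup.mk u) = _
    rw [h1, h2]
    rfl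
  neg_mem' {f} hf v := by
    obtain ⟨a, ha, ha'⟩ := hf v
    refine ⟨-a, ha.neg, ?_⟩
    filter_upwards [ha'] with u h1
    change -(f (QuotientAddGroup.mk u)) = _
    rw [h1]
    rfl

/-- The elliptic curve `ℂ ⧸ L` has complex multiplication by the number field `K`: its rational
endomorphism algebra `ℚ ⊗ End(ℂ ⧸ L)` is isomorphic to `K`. -/
def HasCMBy (L : AddSubgroup ℂ) (K : Type*) [Field K] [NumberField K] : Prop :=
  Nonempty ((ℚ ⊗[ℤ] endRing L) ≃ₐ[ℚ] K)

/-- An imaginary quadratic field. -/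
def IsImaginaryQuadratic (K : Type*) [Field K] [NumberField K] : Prop :=
  Module.finrank ℚ K = 2 ∧ NumberField.IsTotallyComplex K

end Tori

/-! ## Iwasawa manifolds and Iwasawa bundles -/

/-- An Iwasawa manifold: a compact complex manifold `I` (Hausdorff, modelled on a complex vector
space `F` of finite dimension) with a transitive holomorphic action of `G` whose stabilizers are
discrete. -/
class IwasawaManifold (F : Type*) [NormedAddCommGroup F] [NormedSpace ℂ F]
    (I : Type*) [TopologicalSpace I] [ChartedSpace F I] [MulAction G I] : Prop where
  finiteDimensional : FiniteDimensional ℂ F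
  isManifold : IsManifold 𝓘(ℂ, F) ω I
  t2Space : T2Space I
  compactSpace : CompactSpace I
  holomorphic_action : ContMDiff (𝓘(ℂ, ℂ × ℂ × ℂ).prod 𝓘(ℂ, F)) 𝓘(ℂ, F) ω
    (fun q : (ℂ × ℂ × ℂ) × I => (⟨q.1.1, q.1.2.1, q.1.2.2⟩ : G) • q.2)
  transitive : MulAction.IsPretransitive G I
  discrete_stabilizer : ∀ o : I, DiscreteTopology (MulAction.stabilizer G o)

section Bundle

/-- The image `Δ` in `G^ab = ℂ²` of the stabilizer `Λ` of the base point `o`. -/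
noncomputable def baseLattice {I : Type*} [MulAction G I] (o : I) : AddSubgroup (ℂ × ℂ) :=
  Subgroup.toAddSubgroup' ((MulAction.stabilizer G o).map G.ab)

/-- The intersection `Λ ∩ Z(G)` of the stabilizer `Λ` of the base point `o` with the
centre `Z(G) = ℂ`. -/
noncomputable def fibreLattice {I : Type*} [MulAction G I] (o : I) : AddSubgroup ℂ :=
  Subgroup.toAddSubgroup' ((MulAction.stabilizer G o).comap G.central)

/-- The base `T = ℂ² ⧸ Δ` of the Iwasawa bundle. -/
abbrev Base {I : Type*} [MulAction G I] (o : I) : Type := (ℂ × ℂ) ⧸ baseLattice o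

theorem mem_baseLattice {I : Type*} [MulAction G I] (o : I) (v : ℂ × ℂ) :
    v ∈ baseLattice o ↔ ∃ g : G, g • o = o ∧ (g.x, g.z) = v := Iff.rfl

theorem mem_fibreLattice {I : Type*} [MulAction G I] (o : I) (w : ℂ) :
    w ∈ fibreLattice o ↔ (⟨0, w, 0⟩ : G) • o = o := Iff.rfl

/-- The Iwasawa bundle `π : I → T`, which the projection `p : G → G^ab` induces through the
identification `G/Λ = I`, `gΛ ↦ g • o`. -/
noncomputable def bundle {I : Type*} [MulAction G I] [MulAction.IsPretransitive G I] (o : I) :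
    I → Base o :=
  fun q => QuotientAddGroup.mk (G.ab (MulAction.exists_smul_eq G o q).choose).toAdd

theorem bundle_smul {I : Type*} [MulAction G I] [MulAction.IsPretransitive G I] (o : I) (g : G) :
    bundle o (g • o) = QuotientAddGroup.mk (g.x, g.z) := by
  have h := (MulAction.exists_smul_eq G o (g • o)).choose_spec
  refine QuotientAddGroup.eq.mpr ((mem_baseLattice o _).mpr
    ⟨(MulAction.exists_smul_eq G o (g • o)).choose⁻¹ * g, ?_, rfl⟩)
  rw [mul_smul, inv_smul_eq_iff, h]

/-- The fibres of `π` are the orbits of the centre `Z(G) = ℂ`. -/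
theorem bundle_eq_iff {I : Type*} [MulAction G I] [MulAction.IsPretransitive G I] (o p q : I) :
    bundle o p = bundle o q ↔ ∃ w, G.central w • p = q := by
  obtain ⟨g, rfl⟩ := MulAction.exists_smul_eq G o p
  obtain ⟨h, rfl⟩ := MulAction.exists_smul_eq G o q
  rw [bundle_smul, bundle_smul]
  constructor
  · intro e
    obtain ⟨k, hk, e'⟩ := (mem_baseLattice o _).mp (QuotientAddGroup.eq.mp e)
    have hx : k.x = -g.x + h.x := congrArg Prod.fst e'
    have hz : k.z = -g.z + h.z := congrArg Prod.snd e'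
    refine ⟨Multiplicative.ofAdd (h * (g * k)⁻¹).y, ?_⟩
    have e2 : G.central (Multiplicative.ofAdd (h * (g * k)⁻¹).y) = h * (g * k)⁻¹ := by
      ext
      · simp [G.central, hx]
      · simp [G.central]
      · simp [G.central, hz]
    rw [e2, ← mul_smul]
    have e3 : h * (g * k)⁻¹ * g = h * g⁻¹ * (g * k⁻¹ * g⁻¹) * g := by group
    have e4 : k⁻¹ • o = o := by rw [inv_smul_eq_iff, hk]
    rw [e3]
    simp only [mul_smul, inv_smul_smul, e4]
  · rintro ⟨w, e⟩
    rw [← mul_smul] at e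
    have := bundle_smul o (G.central w * g)
    rw [e, bundle_smul] at this
    simpa [G.central] using this.symm

/-- `Z(G) = ℂ` acts on every fibre of `π` with stabilizer `Λ ∩ Z(G)`, so that `E` acts on the
fibres simply transitively. -/
theorem central_smul_eq_iff {I : Type*} [MulAction G I] [MulAction.IsPretransitive G I] (o p : I)
    (w : ℂ) : G.central (Multiplicative.ofAdd w) • p = p ↔ w ∈ fibreLattice o := by
  obtain ⟨g, rfl⟩ := MulAction.exists_smul_eq G o p
  have h : G.central (Multiplicative.ofAdd w) * g = g * G.central (Multiplicative.ofAdd w) := by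
    ext <;> simp [G.central, add_comm]
  rw [mem_fibreLattice, ← mul_smul, h, mul_smul, smul_left_cancel_iff]
  rfl

end Bundle

end Iwasawa

/-! The stabilizer `Λ` of `o` is cocompact in `G`, by the open mapping theorem for the transitive
action of the `σ`-compact group `G` on the compact space `I`; hence `Δ = p(Λ)` spans `ℂ²` over `ℝ`
(`span_baseLattice_eq_top`). Commutators in `Λ` show that the `ℂ`-bilinear alternating form
`wedge` on `ℂ²` maps `Δ × Δ` into `Γ` (`wedge_mem_fibreLattice`). Together
with the discreteness of `Λ ∩ Z(G)` this fact implies everything else.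

The values of `wedge` on `Δ` span `ℂ` over `ℝ`, so the discrete group `Γ` is a lattice. Let
`a, b ∈ Δ` be a basis of `ℂ²` over `ℂ`. The linear automorphism `A v = (wedge v a, wedge v b)` maps
`Δ` into `Γ × Γ`. Thus `Δ` is discrete, a lattice of the same rank as `Γ × Γ`, and `A` induces an
isogeny from `T` to `E × E` (`isogenous_prod_self`): both `E'` and `E''` can be taken to be `E`.

In the coordinates given by `A` the form is the determinant divided by `d = wedge a b`, and `A Δ`
contains `n (Γ × Γ)` for some nonzero integer `n`. Hence `n² l m / d ∈ Γ` for all `l, m ∈ Γ`, which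
says that the numbers `κ = n² l / d` satisfy `κ Γ ⊆ Γ`. Since `Γ` spans `ℂ` over `ℝ`, some such
`κ` is not real (`exists_im_ne_zero_mem_multiplierRing`). As `Γ` has rank two, `κ` is quadratic
over `ℚ`, and the multipliers of `Γ` form an order in `ℚ(κ)`; since the holomorphic endomorphisms
of `ℂ ⧸ Γ` are exactly the multiplications by multipliers (`mulEnd_bijective`), `E` has complex
multiplication by `ℚ(κ)` (`IsLattice.exists_hasCMBy`). -/

namespace Iwasawa

/-! ### Lattices and sublattices of full rank -/

section Lattices

variable {V : Type*} [NormedAddCommGroup V]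

theorem exists_norm_lt_imp_eq_zero {L : AddSubgroup V} (hL : DiscreteTopology L) :
    ∃ ε > 0, ∀ l ∈ L, ‖l‖ < ε → l = 0 := by
  obtain ⟨ε, hε, h⟩ := Metric.exists_ball_inter_eq_singleton_of_mem_discrete (s := (L : Set V))
    ⟨hL⟩ L.zero_mem
  refine ⟨ε, hε, fun l hl hlt => ?_⟩
  have : l ∈ Metric.ball (0 : V) ε ∩ L := ⟨by simpa using hlt, hl⟩
  rw [h] at this
  exact this

theorem discreteTopology_of_norm_lt {L : AddSubgroup V} {ε : ℝ} (hε : 0 < ε)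
    (h : ∀ l ∈ L, ‖l‖ < ε → l = 0) : DiscreteTopology L := by
  refine discreteTopology_of_isOpen_singleton_zero ?_
  rw [Metric.isOpen_singleton_iff]
  refine ⟨ε, hε, fun l hl => Subtype.ext (h l l.2 ?_)⟩
  simpa using hl

variable [NormedSpace ℂ V]

theorem IsLattice.of_le {L M : AddSubgroup V} (hL : IsLattice L) (hML : M ≤ L)
    (hM : Submodule.span ℝ (M : Set V) = ⊤) : IsLattice M :=
  have := hL.1
  ⟨DiscreteTopology.of_continuous_injective (continuous_inclusion hML)
    (Set.inclusion_injective hML), hM⟩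

theorem IsLattice.module_finite [FiniteDimensional ℂ V] {L : AddSubgroup V} (hL : IsLattice L) :
    Module.Finite ℤ L := by
  have : FiniteDimensional ℝ V := FiniteDimensional.complexToReal V
  have : DiscreteTopology (AddSubgroup.toIntSubmodule L) := hL.1
  have : IsZLattice ℝ (AddSubgroup.toIntSubmodule L) := ⟨hL.2⟩
  exact ZLattice.module_finite ℝ (AddSubgroup.toIntSubmodule L)

theorem IsLattice.module_free [FiniteDimensional ℂ V] {L : AddSubgroup V} (hL : IsLattice L) :
    Module.Free ℤ L := by
  have : FiniteDimensional ℝ V := FiniteDimensional.complexToReal V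
  have : DiscreteTopology (AddSubgroup.toIntSubmodule L) := hL.1
  have : IsZLattice ℝ (AddSubgroup.toIntSubmodule L) := ⟨hL.2⟩
  exact ZLattice.module_free ℝ (AddSubgroup.toIntSubmodule L)

theorem IsLattice.finrank_eq [FiniteDimensional ℂ V] {L : AddSubgroup V} (hL : IsLattice L) :
    Module.finrank ℤ L = Module.finrank ℝ V := by
  have : FiniteDimensional ℝ V := FiniteDimensional.complexToReal V
  have : DiscreteTopology (AddSubgroup.toIntSubmodule L) := hL.1
  have : IsZLattice ℝ (AddSubgroup.toIntSubmodule L) := ⟨hL.2⟩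
  exact ZLattice.rank ℝ (AddSubgroup.toIntSubmodule L)

/-- A subgroup of a lattice that still spans over `ℝ` has finite index. -/
theorem IsLattice.exists_zsmul_mem [FiniteDimensional ℂ V] {L M : AddSubgroup V}
    (hL : IsLattice L) (hML : M ≤ L) (hM : Submodule.span ℝ (M : Set V) = ⊤) :
    ∃ n : ℤ, n ≠ 0 ∧ ∀ l ∈ L, n • l ∈ M := by
  have := hL.module_finite
  have := hL.module_free
  let N : Submodule ℤ L := AddSubgroup.toIntSubmodule (M.addSubgroupOf L)
  have hN : Module.finrank ℤ N = Module.finrank ℤ L := by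
    rw [hL.finrank_eq, ← (hL.of_le hML hM).finrank_eq]
    exact (AddSubgroup.addSubgroupOfEquivOfLe hML).toIntLinearEquiv.finrank_eq
  have : Finite (L ⧸ N) := Submodule.finiteQuotientOfFreeOfRankEq N hN
  refine ⟨Nat.card (L ⧸ N), mod_cast Nat.card_pos.ne', fun l hl => ?_⟩
  have h : (Submodule.Quotient.mk ((Nat.card (L ⧸ N)) • (⟨l, hl⟩ : L)) : L ⧸ N) = 0 := by
    rw [Submodule.Quotient.mk_smul]
    exact card_nsmul_eq_zero'
  have h' := (Submodule.Quotient.mk_eq_zero N).1 h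
  rw [natCast_zsmul]
  exact h'

theorem IsLattice.prod {W : Type*} [NormedAddCommGroup W] [NormedSpace ℂ W] {L : AddSubgroup V}
    {M : AddSubgroup W} (hL : IsLattice L) (hM : IsLattice M) : IsLattice (L.prod M) := by
  constructor
  · have := hL.1
    have := hM.1
    let f : L.prod M → L × M := fun p => (⟨p.1.1, p.2.1⟩, ⟨p.1.2, p.2.2⟩)
    refine DiscreteTopology.of_continuous_injective (f := f) ?_ ?_
    · fun_prop
    · intro p q h
      ext
      · exact congrArg (fun r : L × M => (r.1 : V)) h
      · exact congrArg (fun r : L × M => (r.2 : W)) h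
  · have h := Submodule.span_prod_eq ℝ (s := (L : Set V)) (t := (M : Set W)) L.zero_mem M.zero_mem
    rw [hL.2, hM.2, Submodule.prod_top] at h
    exact h

/-- A real subspace whose translates by a bounded set cover is the whole space. -/
theorem span_eq_top_of_cobounded [FiniteDimensional ℂ V] {S : Submodule ℝ V} {R : ℝ}
    (h : ∀ v, ∃ b : V, ‖b‖ ≤ R ∧ v - b ∈ S) : S = ⊤ := by
  have : FiniteDimensional ℝ V := FiniteDimensional.complexToReal V
  by_contra hS
  obtain ⟨f, hf, hSf⟩ := Submodule.exists_le_ker_of_lt_top S (lt_top_iff_ne_top.2 hS)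
  obtain ⟨v, hv⟩ : ∃ v, f v ≠ 0 := by
    by_contra! h0
    exact hf (LinearMap.ext h0)
  let g : V →L[ℝ] ℝ := LinearMap.toContinuousLinearMap f
  obtain ⟨b, hb, hvb⟩ := h (((‖g‖ * R + 1) / f v) • v)
  have h1 := hSf hvb
  rw [LinearMap.mem_ker, map_sub, map_smul, smul_eq_mul, div_mul_cancel₀ _ hv] at h1
  have h2 : |f b| ≤ ‖g‖ * ‖b‖ := g.le_opNorm b
  have h3 : ‖g‖ * ‖b‖ ≤ ‖g‖ * R := by gcongr
  linarith [le_abs_self (f b)]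

end Lattices

/-! ### Endomorphisms of one-dimensional complex tori -/

/-- The multiplier ring of a subgroup `L` of `ℂ`: the complex numbers `a` with `a L ⊆ L`. -/
def multiplierRing (L : AddSubgroup ℂ) : Subring ℂ where
  carrier := {a | ∀ l ∈ L, a * l ∈ L}
  one_mem' l hl := by rwa [one_mul]
  zero_mem' l _ := by simp
  mul_mem' {a b} ha hb l hl := by
    rw [mul_assoc]
    exact ha _ (hb l hl)
  add_mem' {a b} ha hb l hl := by
    rw [add_mul]
    exact L.add_mem (ha l hl) (hb l hl)
  neg_mem' {a} ha l hl := by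
    rw [neg_mul]
    exact L.neg_mem (ha l hl)

theorem mem_multiplierRing {L : AddSubgroup ℂ} {a : ℂ} :
    a ∈ multiplierRing L ↔ ∀ l ∈ L, a * l ∈ L := Iff.rfl

/-- Multiplication by an element of the multiplier ring, as an endomorphism of `ℂ ⧸ L`. -/
def mulEnd (L : AddSubgroup ℂ) : multiplierRing L →+* endRing L where
  toFun a := ⟨QuotientAddGroup.map L L (AddMonoidHom.mulLeft (a : ℂ)) a.2,
    fun _ => ⟨fun u => (a : ℂ) * u, analyticAt_const.mul analyticAt_id,
      Filter.Eventually.of_forall fun _ => rfl⟩⟩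
  map_one' := by
    refine Subtype.ext (AddMonoidHom.ext fun x => ?_)
    induction x using QuotientAddGroup.induction_on with | _ u
    exact congrArg QuotientAddGroup.mk (one_mul u)
  map_zero' := by
    refine Subtype.ext (AddMonoidHom.ext fun x => ?_)
    induction x using QuotientAddGroup.induction_on with | _ u
    exact congrArg QuotientAddGroup.mk (zero_mul u)
  map_mul' a b := by
    refine Subtype.ext (AddMonoidHom.ext fun x => ?_)
    induction x using QuotientAddGroup.induction_on with | _ u
    exact congrArg QuotientAddGroup.mk (mul_assoc (a : ℂ) b u)
  map_add' a b := by
    refine Subtype.ext (AddMonoidHom.ext fun x => ?_)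
    induction x using QuotientAddGroup.induction_on with | _ u
    exact congrArg QuotientAddGroup.mk (add_mul (a : ℂ) b u)

theorem mulEnd_mk (L : AddSubgroup ℂ) (a : multiplierRing L) (u : ℂ) :
    (mulEnd L a).1 (QuotientAddGroup.mk u) = QuotientAddGroup.mk (a * u) := rfl

theorem mulEnd_injective {L : AddSubgroup ℂ} (hL : DiscreteTopology L) :
    Function.Injective (mulEnd L) := by
  rw [injective_iff_map_eq_zero]
  intro a ha
  obtain ⟨ε, hε, h⟩ := exists_norm_lt_imp_eq_zero hL
  have hmem (u : ℂ) : (a : ℂ) * u ∈ L := by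
    have := mulEnd_mk L a u
    rw [ha] at this
    exact (QuotientAddGroup.eq_zero_iff _).1 this.symm
  have hcont : Filter.Tendsto (fun u : ℂ => ‖(a : ℂ) * u‖) (𝓝 0) (𝓝 0) := by
    have : Continuous fun u : ℂ => ‖(a : ℂ) * u‖ := by fun_prop
    simpa using this.tendsto 0
  have hev : ∀ᶠ u in 𝓝[≠] (0 : ℂ), ‖(a : ℂ) * u‖ < ε :=
    (hcont.eventually (gt_mem_nhds hε)).filter_mono nhdsWithin_le_nhds
  obtain ⟨u, hu, hu0⟩ := (hev.and self_mem_nhdsWithin).exists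
  exact Subtype.ext ((mul_eq_zero.1 (h _ (hmem u) hu)).resolve_right hu0)

/-- A holomorphic endomorphism of `ℂ ⧸ L` lifts to multiplication by a complex number. The local
lift at `0` is additive up to elements of `L`, hence additive near `0` by discreteness; comparing
derivatives, it is linear there. -/
theorem exists_eq_mul_of_isHolomorphic {L : AddSubgroup ℂ} (hL : DiscreteTopology L)
    (f : ℂ ⧸ L →+ ℂ ⧸ L) (hf : IsHolomorphic f) :
    ∃ a : ℂ, ∀ u : ℂ, f (QuotientAddGroup.mk u) = QuotientAddGroup.mk (a * u) := by
  obtain ⟨F, hF, hfF⟩ := hf 0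
  obtain ⟨ε, hε, hLε⟩ := exists_norm_lt_imp_eq_zero hL
  have hsmall : ∀ᶠ u in 𝓝 (0 : ℂ), ‖F u - F 0‖ < ε / 3 := by
    have : Filter.Tendsto (fun u => ‖F u - F 0‖) (𝓝 0) (𝓝 0) := by
      have h := (hF.continuousAt.sub_const (F 0)).norm
      simpa [ContinuousAt] using h
    exact this.eventually (gt_mem_nhds (by positivity))
  obtain ⟨r, hr, hball⟩ := Metric.eventually_nhds_iff.1
    ((hfF.and hsmall).and hF.eventually_analyticAt)
  simp only [dist_zero_right] at hball
  have hF0 : F 0 ∈ L := by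
    have h := (hball (y := 0) (by simpa using hr)).1.1
    rw [← QuotientAddGroup.eq_zero_iff, ← h]
    exact map_zero f
  have hadd : ∀ u v : ℂ, ‖u‖ < r / 2 → ‖v‖ < r / 2 → F (u + v) = F u + F v - F 0 := by
    intro u v hu hv
    have huv : ‖u + v‖ < r := (norm_add_le u v).trans_lt (by linarith)
    have h1 := (hball (y := u) (by linarith)).1
    have h2 := (hball (y := v) (by linarith)).1
    have h3 := (hball huv).1
    have hmem : F (u + v) - F u - F v ∈ L := by
      rw [← QuotientAddGroup.eq_zero_iff, QuotientAddGroup.mk_sub, QuotientAddGroup.mk_sub,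
        ← h1.1, ← h2.1, ← h3.1, QuotientAddGroup.mk_add, map_add]
      abel
    have h4 := hLε _ (L.add_mem hmem hF0) (by
      have e : F (u + v) - F u - F v + F 0 = (F (u + v) - F 0) - (F u - F 0) - (F v - F 0) := by
        ring
      rw [e]
      refine (norm_sub_le _ _).trans_lt ?_
      have := norm_sub_le (F (u + v) - F 0) (F u - F 0)
      linarith [h1.2, h2.2, h3.2])
    linear_combination h4
  have hderiv : ∀ v : ℂ, ‖v‖ < r / 2 → HasDerivAt F (deriv F 0) v := by
    intro v hv
    have h0 : HasDerivAt F (deriv F 0) (v - v) := by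
      rw [sub_self]
      exact hF.differentiableAt.hasDerivAt
    have h1 : HasDerivAt (fun w => F (w - v) + F v - F 0) (deriv F 0) v :=
      ((h0.comp_sub_const v v).add_const _).sub_const _
    refine h1.congr_of_eventuallyEq ?_
    have : ∀ᶠ w in 𝓝 v, ‖w - v‖ < r / 2 := by
      have := Metric.ball_mem_nhds v (half_pos hr)
      filter_upwards [this] with w hw
      simpa [dist_eq_norm] using hw
    filter_upwards [this] with w hw
    simpa using hadd (w - v) v hw hv
  set a := deriv F 0
  have hlin : ∀ v : ℂ, ‖v‖ < r / 2 → F v = a * v + F 0 := by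
    intro v hv
    have hd : ∀ x ∈ Metric.ball (0 : ℂ) (r / 2), HasDerivAt (fun w => F w - a * w) 0 x := by
      intro x hx
      have h1 := (hderiv x (by simpa using hx)).sub ((hasDerivAt_id x).const_mul a)
      rwa [mul_one, sub_self] at h1
    have h := Metric.isOpen_ball.is_const_of_deriv_eq_zero
      (convex_ball (0 : ℂ) (r / 2)).isPreconnected
      (fun x hx => (hd x hx).differentiableAt.differentiableWithinAt)
      (fun x hx => (hd x hx).deriv) (x := v) (y := 0) (by simpa using hv) (by simpa using hr)
    simp only [mul_zero, sub_zero] at h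
    linear_combination h
  have hloc : ∀ v : ℂ, ‖v‖ < r / 2 →
      f (QuotientAddGroup.mk v) = QuotientAddGroup.mk (a * v) := by
    intro v hv
    rw [(hball (y := v) (by linarith)).1.1, hlin v hv, QuotientAddGroup.mk_add,
      (QuotientAddGroup.eq_zero_iff _).2 hF0, add_zero]
  refine ⟨a, fun u => ?_⟩
  obtain ⟨n, hn⟩ := exists_nat_gt (‖u‖ / (r / 2))
  have hn0 : (0 : ℝ) < n := lt_of_le_of_lt (by positivity) hn
  have hnC : (n : ℂ) ≠ 0 := by
    intro h
    simp [Nat.cast_eq_zero.1 h] at hn0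
  have hu : ‖u / n‖ < r / 2 := by
    rw [norm_div, Complex.norm_natCast, div_lt_iff₀ hn0]
    rwa [div_lt_iff₀ (half_pos hr), mul_comm] at hn
  have e1 : u = n • (u / n) := by
    rw [nsmul_eq_mul]
    field_simp
  have e2 : a * u = n • (a * (u / n)) := by
    rw [nsmul_eq_mul]
    field_simp
  rw [e2, QuotientAddGroup.mk_nsmul, ← hloc _ hu, ← map_nsmul, ← QuotientAddGroup.mk_nsmul, ← e1]

theorem mulEnd_bijective {L : AddSubgroup ℂ} (hL : DiscreteTopology L) :
    Function.Bijective (mulEnd L) := by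
  refine ⟨mulEnd_injective hL, fun f => ?_⟩
  obtain ⟨a, ha⟩ := exists_eq_mul_of_isHolomorphic hL f.1 f.2
  refine ⟨⟨a, fun l hl => ?_⟩, Subtype.ext (AddMonoidHom.ext fun x => ?_)⟩
  · rw [← QuotientAddGroup.eq_zero_iff, ← ha, (QuotientAddGroup.eq_zero_iff l).2 hl]
    exact map_zero f.1
  · induction x using QuotientAddGroup.induction_on with | _ u
    exact (ha u).symm

/-! ### Complex multiplication from one non-real multiplier -/

/-- A ring embedded in a field `K` of characteristic zero such that every element of `K` has a
nonzero integral multiple in it satisfies `ℚ ⊗ R ≃ K`. -/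
theorem nonempty_rat_tensor_algEquiv {R K : Type*} [Ring R] [Field K] [CharZero K]
    (φ : R →+* K) (hφ : Function.Injective φ)
    (hK : ∀ k : K, ∃ n : ℤ, n ≠ 0 ∧ ∃ r, φ r = n * k) : Nonempty ((ℚ ⊗[ℤ] R) ≃ₐ[ℚ] K) := by
  let ψ : (ℚ ⊗[ℤ] R) →ₐ[ℚ] K := Algebra.TensorProduct.lift (Algebra.ofId ℚ K)
    (φ.toIntAlgHom) (fun _ _ => mul_comm _ _)
  have hψ (q : ℚ) (r : R) : ψ (q ⊗ₜ r) = q * φ r := by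
    refine (Algebra.TensorProduct.lift_tmul _ _ _ q r).trans ?_
    rw [Algebra.ofId_apply, eq_ratCast]
    rfl
  -- every element of the tensor product has a common denominator
  have hden (t : ℚ ⊗[ℤ] R) : ∃ n : ℤ, n ≠ 0 ∧ ∃ r : R, (n : ℤ) • t = (1 : ℚ) ⊗ₜ r := by
    induction t using TensorProduct.induction_on with
    | zero => exact ⟨1, one_ne_zero, 0, by simp⟩
    | tmul q r =>
      refine ⟨q.den, mod_cast q.den_nz, q.num • r, ?_⟩
      rw [← TensorProduct.smul_tmul, TensorProduct.smul_tmul']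
      congr 1
      rw [zsmul_eq_mul, zsmul_eq_mul, mul_one, Int.cast_natCast, Rat.den_mul_eq_num]
    | add s t hs ht =>
      obtain ⟨m, hm, a, ha⟩ := hs
      obtain ⟨n, hn, b, hb⟩ := ht
      refine ⟨n * m, mul_ne_zero hn hm, n • a + m • b, ?_⟩
      rw [smul_add, mul_smul, ha, mul_comm, mul_smul, hb, TensorProduct.tmul_add,
        TensorProduct.tmul_smul, TensorProduct.tmul_smul]
  refine ⟨AlgEquiv.ofBijective ψ ⟨?_, fun k => ?_⟩⟩
  · rw [injective_iff_map_eq_zero]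
    intro t ht
    obtain ⟨n, hn, r, hr⟩ := hden t
    have h1 : φ r = 0 := by
      have h := hψ 1 r
      rw [← hr, map_zsmul, ht, smul_zero] at h
      simpa using h.symm
    rw [(injective_iff_map_eq_zero φ).1 hφ r h1, TensorProduct.tmul_zero, ← Int.cast_smul_eq_zsmul ℚ]
      at hr
    exact (smul_eq_zero.1 hr).resolve_left (mod_cast hn)
  · obtain ⟨n, hn, r, hr⟩ := hK k
    refine ⟨((n : ℚ)⁻¹) ⊗ₜ r, ?_⟩
    rw [hψ, hr]
    have : (n : K) ≠ 0 := mod_cast hn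
    push_cast
    field_simp

/-- Two complex numbers with non-real ratio span `ℂ` over `ℝ`. -/
theorem span_pair_eq_top {c κ : ℂ} (hc : c ≠ 0) (hκ : κ.im ≠ 0) :
    Submodule.span ℝ ({c, κ * c} : Set ℂ) = ⊤ := by
  rw [eq_top_iff]
  intro w _
  rw [Submodule.mem_span_pair]
  refine ⟨(w / c).re - (w / c).im / κ.im * κ.re, (w / c).im / κ.im, ?_⟩
  have h : (((w / c).re - (w / c).im / κ.im * κ.re : ℝ) : ℂ) + ((w / c).im / κ.im : ℝ) * κ
      = w / c := by
    apply Complex.ext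
    · simp
    · simp
      field_simp
  rw [Complex.real_smul, Complex.real_smul, ← mul_assoc, ← add_mul, h, div_mul_cancel₀ _ hc]

/-- If `κ` is a non-real multiplier of the lattice `L` and `0 ≠ c ∈ L`, then `ℤ c + ℤ κ c` has
finite index in `L`. -/
theorem IsLattice.exists_zsmul_eq {L : AddSubgroup ℂ} (hL : IsLattice L) {κ : ℂ}
    (hκ : κ ∈ multiplierRing L) (him : κ.im ≠ 0) {c : ℂ} (hcL : c ∈ L) (hc : c ≠ 0) :
    ∃ n : ℤ, n ≠ 0 ∧ ∀ l ∈ L, ∃ a b : ℤ, (n : ℂ) * l = (a + b * κ) * c := by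
  obtain ⟨n, hn, h⟩ := hL.exists_zsmul_mem (M := AddSubgroup.closure {c, κ * c})
    ((AddSubgroup.closure_le _).2 (by
      rintro x (rfl | rfl)
      · exact hcL
      · exact hκ _ hcL))
    (eq_top_mono (Submodule.span_mono AddSubgroup.subset_closure) (span_pair_eq_top hc him))
  refine ⟨n, hn, fun l hl => ?_⟩
  obtain ⟨a, b, e⟩ := AddSubgroup.mem_closure_pair.1 (h l hl)
  refine ⟨a, b, ?_⟩
  simp only [zsmul_eq_mul] at e
  linear_combination -e

theorem IsLattice.exists_ne_zero {L : AddSubgroup ℂ} (hL : IsLattice L) :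
    ∃ c ∈ L, c ≠ 0 := by
  by_contra! h
  have h1 : (L : Set ℂ) ⊆ {0} := h
  have h2 := hL.2
  rw [eq_bot_iff.2 ((Submodule.span_mono h1).trans (by simp))] at h2
  exact bot_ne_top h2

open IntermediateField in
/-- A lattice in `ℂ` with a non-real multiplier `κ` has complex multiplication by the imaginary
quadratic field `ℚ(κ)`. -/
theorem IsLattice.exists_hasCMBy {L : AddSubgroup ℂ} (hL : IsLattice L) {κ : ℂ}
    (hκ : κ ∈ multiplierRing L) (him : κ.im ≠ 0) :
    ∃ (K : Type) (_ : Field K) (_ : NumberField K), IsImaginaryQuadratic K ∧ HasCMBy L K := by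
  obtain ⟨c, hcL, hc⟩ := hL.exists_ne_zero
  obtain ⟨n, hn, hrel⟩ := hL.exists_zsmul_eq hκ him hcL hc
  have hnC : (n : ℂ) ≠ 0 := mod_cast hn
  obtain ⟨a, b, hab⟩ := hrel _ (hκ _ (hκ _ hcL))
  have hquad : (n : ℂ) * κ ^ 2 = a + b * κ := by
    apply mul_right_cancel₀ hc
    linear_combination hab
  -- the minimal polynomial of `κ` divides this monic polynomial
  let P : Polynomial ℚ := .C 1 * .X ^ 2 + .C (-b / n : ℚ) * .X + .C (-a / n : ℚ)
  have hPd : P.natDegree = 2 := Polynomial.natDegree_quadratic one_ne_zero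
  have hPm : P.Monic := Polynomial.leadingCoeff_quadratic one_ne_zero
  have hPκ : Polynomial.aeval κ P = 0 := by
    simp only [P, map_add, map_mul, map_pow, Polynomial.aeval_X, Polynomial.aeval_C,
      eq_ratCast]
    push_cast
    field_simp
    linear_combination hquad
  have hint : IsIntegral ℚ κ := ⟨P, hPm, by rwa [← Polynomial.aeval_def]⟩
  have hfin : FiniteDimensional ℚ ℚ⟮κ⟯ := adjoin.finiteDimensional hint
  have hnum : NumberField ℚ⟮κ⟯ := { }
  have hrank : Module.finrank ℚ ℚ⟮κ⟯ = 2 := by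
    rw [adjoin.finrank hint]
    apply le_antisymm
    · rw [← hPd]
      exact Polynomial.natDegree_le_of_dvd (minpoly.dvd ℚ κ hPκ) hPm.ne_zero
    · rw [minpoly.two_le_natDegree_iff hint]
      rintro ⟨q, hq⟩
      apply him
      rw [← hq]
      simp
  refine ⟨ℚ⟮κ⟯, inferInstance, hnum, ⟨hrank, ⟨fun w => ?_⟩⟩, ?_⟩
  · -- a real embedding would send `κ` to a real root of the polynomial with roots `κ`, `conj κ`
    rw [← NumberField.InfinitePlace.not_isReal_iff_isComplex]
    intro hw
    let σ := NumberField.InfinitePlace.embedding_of_isReal hw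
    have hgen : (n : ℚ⟮κ⟯) * AdjoinSimple.gen ℚ κ ^ 2 = a + b * AdjoinSimple.gen ℚ κ :=
      Subtype.ext (by simpa using hquad)
    have ht := congrArg σ hgen
    simp only [map_mul, map_pow, map_add, map_intCast] at ht
    set t := σ (AdjoinSimple.gen ℚ κ)
    have hre := congrArg Complex.re hquad
    have hIm := congrArg Complex.im hquad
    simp only [pow_two, Complex.mul_re, Complex.mul_im, Complex.add_re, Complex.add_im,
      Complex.intCast_re, Complex.intCast_im] at hre hIm
    have hb : (b : ℝ) = 2 * n * κ.re := by
      apply mul_right_cancel₀ him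
      linear_combination -hIm
    have h0 : (n : ℝ) * ((t - κ.re) ^ 2 + κ.im ^ 2) = 0 := by
      linear_combination ht - hre + (t - κ.re) * hb
    have hnR : (n : ℝ) ≠ 0 := mod_cast hn
    have h1 := (mul_eq_zero.1 h0).resolve_left hnR
    have h2 : 0 < κ.im ^ 2 := by positivity
    nlinarith [sq_nonneg (t - κ.re)]
  · -- multipliers lie in `ℚ(κ)`
    have hsub : ∀ x ∈ multiplierRing L, x ∈ ℚ⟮κ⟯ := by
      intro x hx
      obtain ⟨p, q, hpq⟩ := hrel _ (hx _ hcL)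
      have e : x = (p + q * κ) / n := by
        rw [eq_div_iff hnC]
        apply mul_right_cancel₀ hc
        linear_combination hpq
      have hmem := mem_adjoin_simple_self ℚ κ
      rw [e]
      exact div_mem (add_mem (intCast_mem _ p) (mul_mem (intCast_mem _ q) hmem)) (intCast_mem _ n)
    have hfrac : ∀ x ∈ ℚ⟮κ⟯, ∃ m : ℤ, m ≠ 0 ∧ m * x ∈ multiplierRing L := by
      intro x hx
      rw [← mem_toSubalgebra, adjoin_simple_toSubalgebra_of_isAlgebraic hint.isAlgebraic] at hx
      induction hx using Algebra.adjoin_induction with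
      | mem x hx =>
        rw [Set.mem_singleton_iff.1 hx]
        exact ⟨1, one_ne_zero, by simpa using hκ⟩
      | algebraMap q =>
        refine ⟨q.den, mod_cast q.den_nz, ?_⟩
        have : (((q.den : ℤ) : ℂ)) * (algebraMap ℚ ℂ q) = (q.num : ℂ) := by
          rw [eq_ratCast]
          exact_mod_cast congrArg (Rat.cast (K := ℂ)) (Rat.den_mul_eq_num q)
        rw [this]
        exact intCast_mem _ _
      | add x y _ _ hx hy =>
        obtain ⟨m, hm, h1⟩ := hx
        obtain ⟨k, hk, h2⟩ := hy
        refine ⟨m * k, mul_ne_zero hm hk, ?_⟩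
        have e : ((m * k : ℤ) : ℂ) * (x + y) = k * (m * x) + m * (k * y) := by
          push_cast
          ring
        rw [e]
        exact add_mem (mul_mem (intCast_mem _ k) h1) (mul_mem (intCast_mem _ m) h2)
      | mul x y _ _ hx hy =>
        obtain ⟨m, hm, h1⟩ := hx
        obtain ⟨k, hk, h2⟩ := hy
        refine ⟨m * k, mul_ne_zero hm hk, ?_⟩
        have e : ((m * k : ℤ) : ℂ) * (x * y) = (m * x) * (k * y) := by
          push_cast
          ring
        rw [e]
        exact mul_mem h1 h2
    let e : multiplierRing L ≃+* endRing L :=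
      RingEquiv.ofBijective (mulEnd L) (mulEnd_bijective hL.1)
    let ι : multiplierRing L →+* ℚ⟮κ⟯ :=
      ((multiplierRing L).subtype).codRestrict ℚ⟮κ⟯ fun x => hsub x x.2
    refine nonempty_rat_tensor_algEquiv (ι.comp (e.symm : endRing L →+* multiplierRing L)) ?_ ?_
    · refine Function.Injective.comp (g := ι) (fun x y h => ?_) e.symm.injective
      exact Subtype.ext (congrArg (fun k : ℚ⟮κ⟯ => (k : ℂ)) h)
    · intro k
      obtain ⟨m, hm, h⟩ := hfrac k k.2
      refine ⟨m, hm, e ⟨m * k, h⟩, ?_⟩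
      refine Subtype.ext ?_
      change ((e.symm (e ⟨m * k, h⟩) : multiplierRing L) : ℂ) = _
      simp

/-! ### Subgroups of `ℂ²` with an alternating form in a lattice -/

/-- The standard alternating form on `ℂ²`; it is the commutator pairing of `G`. -/
def wedge (v w : ℂ × ℂ) : ℂ := v.1 * w.2 - w.1 * v.2

theorem wedge_swap (v w : ℂ × ℂ) : wedge w v = -wedge v w := by
  simp only [wedge]
  ring

/-- The map `v ↦ wedge v w` as a `ℂ`-linear map. -/
noncomputable def wedgeLeft (w : ℂ × ℂ) : ℂ × ℂ →ₗ[ℂ] ℂ :=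
  w.2 • LinearMap.fst ℂ ℂ ℂ - w.1 • LinearMap.snd ℂ ℂ ℂ

theorem wedgeLeft_apply (w v : ℂ × ℂ) : wedgeLeft w v = wedge v w := by
  simp only [wedgeLeft, wedge, LinearMap.sub_apply, LinearMap.smul_apply, LinearMap.fst_apply,
    LinearMap.snd_apply, smul_eq_mul]
  ring

/-- If `D` spans `ℂ²` over `ℝ`, the values of the alternating form on `D` span `ℂ` over `ℝ`: a real
subspace containing them contains all values of the form, by real bilinearity. -/
theorem span_wedge_eq_top {D : AddSubgroup (ℂ × ℂ)} (hD : Submodule.span ℝ (D : Set (ℂ × ℂ)) = ⊤)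
    {S : Submodule ℝ ℂ} (hS : ∀ v ∈ D, ∀ w ∈ D, wedge v w ∈ S) : S = ⊤ := by
  have key : ∀ (w : ℂ × ℂ), (∀ v ∈ D, wedge v w ∈ S) → ∀ v, wedge v w ∈ S := by
    intro w h v
    have hle : Submodule.span ℝ (D : Set (ℂ × ℂ)) ≤
        S.comap ((wedgeLeft w).restrictScalars ℝ) := by
      rw [Submodule.span_le]
      intro x hx
      change wedgeLeft w x ∈ S
      rw [wedgeLeft_apply]
      exact h x hx
    rw [hD] at hle
    have := hle (Submodule.mem_top (x := v))
    change wedgeLeft w v ∈ S at this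
    rwa [wedgeLeft_apply] at this
  have h1 : ∀ w v, wedge v w ∈ S := fun w => key w fun v hv => by
    rw [wedge_swap, ← neg_mem_iff, neg_neg]
    exact key v (fun x hx => hS x hx v hv) w
  rw [eq_top_iff]
  intro c _
  simpa [wedge] using h1 (0, 1) (c, 0)

/-- A subgroup spanning `ℂ²` over `ℝ` contains a `ℂ`-basis of `ℂ²`. -/
theorem exists_wedge_ne_zero {D : AddSubgroup (ℂ × ℂ)}
    (hD : Submodule.span ℝ (D : Set (ℂ × ℂ)) = ⊤) : ∃ v ∈ D, ∃ w ∈ D, wedge v w ≠ 0 := by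
  by_contra! h
  exact bot_ne_top (span_wedge_eq_top hD (S := ⊥) h)

/-- The map `v ↦ (wedge v a, wedge v b)` attached to a basis `a`, `b` of `ℂ²`, as a linear
automorphism of `ℂ²`. -/
noncomputable def wedgeEquiv (a b : ℂ × ℂ) (h : wedge a b ≠ 0) : (ℂ × ℂ) ≃ₗ[ℂ] (ℂ × ℂ) :=
  LinearEquiv.ofLinearMap ((wedgeLeft a).prod (wedgeLeft b))
    ((wedge a b)⁻¹ • ((LinearMap.snd ℂ ℂ ℂ).smulRight a - (LinearMap.fst ℂ ℂ ℂ).smulRight b))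
    (by
      refine LinearMap.ext fun v => Prod.ext ?_ ?_
      all_goals
        simp [wedgeLeft_apply]
        field_simp
        simp only [wedge, Prod.fst_sub, Prod.snd_sub, Prod.smul_fst, Prod.smul_snd, smul_eq_mul]
        ring)
    (by
      refine LinearMap.ext fun v => Prod.ext ?_ ?_
      all_goals
        simp [wedgeLeft_apply]
        field_simp
        simp only [wedge]
        ring)

theorem wedgeEquiv_apply {a b : ℂ × ℂ} (h : wedge a b ≠ 0) (v : ℂ × ℂ) :
    wedgeEquiv a b h v = (wedge v a, wedge v b) :=
  Prod.ext (wedgeLeft_apply a v) (wedgeLeft_apply b v)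

/-- If `D` spans `ℂ²` and its alternating form takes values in a discrete group, `D` is discrete:
a short vector of `D` is orthogonal to a basis contained in `D`. -/
theorem discreteTopology_of_wedge_mem {D : AddSubgroup (ℂ × ℂ)} {L : AddSubgroup ℂ}
    (hD : Submodule.span ℝ (D : Set (ℂ × ℂ)) = ⊤) (hDL : ∀ v ∈ D, ∀ w ∈ D, wedge v w ∈ L)
    (hL : DiscreteTopology L) : DiscreteTopology D := by
  obtain ⟨a, ha, b, hb, hab⟩ := exists_wedge_ne_zero hD
  obtain ⟨ε, hε, h⟩ := exists_norm_lt_imp_eq_zero hL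
  have hcont : Continuous fun v => ‖wedge v a‖ + ‖wedge v b‖ := by
    unfold wedge
    fun_prop
  have h0 : ∀ᶠ v in 𝓝 (0 : ℂ × ℂ), ‖wedge v a‖ + ‖wedge v b‖ < ε :=
    (hcont.tendsto' 0 0 (by simp [wedge])).eventually (gt_mem_nhds hε)
  obtain ⟨r, hr, hball⟩ := Metric.eventually_nhds_iff.1 h0
  refine discreteTopology_of_norm_lt hr fun v hv hvr => ?_
  have hlt := hball (y := v) (by simpa using hvr)
  have hva := h _ (hDL v hv a ha) (by linarith [norm_nonneg (wedge v b)])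
  have hvb := h _ (hDL v hv b hb) (by linarith [norm_nonneg (wedge v a)])
  refine (wedgeEquiv a b hab).map_eq_zero_iff.1 (Prod.ext ?_ ?_)
  · rw [wedgeEquiv_apply]
    exact hva
  · rw [wedgeEquiv_apply]
    exact hvb

/-- The pairing with a basis `a`, `b` contained in `D` embeds `D` in `L × L` with finite index. -/
theorem exists_zsmul_mem_map_wedgeEquiv {D : AddSubgroup (ℂ × ℂ)} {L : AddSubgroup ℂ}
    (hD : Submodule.span ℝ (D : Set (ℂ × ℂ)) = ⊤) (hDL : ∀ v ∈ D, ∀ w ∈ D, wedge v w ∈ L)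
    (hL : IsLattice L) {a b : ℂ × ℂ} (ha : a ∈ D) (hb : b ∈ D)
    (hab : wedge a b ≠ 0) :
    ∃ n : ℤ, n ≠ 0 ∧ ∀ p ∈ L.prod L, ∃ v ∈ D, wedgeEquiv a b hab v = n • p := by
  let A := wedgeEquiv a b hab
  have hmap : D.map (A : ℂ × ℂ →+ ℂ × ℂ) ≤ L.prod L := by
    rintro _ ⟨v, hv, rfl⟩
    change wedgeEquiv a b hab v ∈ _
    rw [wedgeEquiv_apply]
    exact ⟨hDL v hv a ha, hDL v hv b hb⟩
  have hspan : Submodule.span ℝ (D.map (A : ℂ × ℂ →+ ℂ × ℂ) : Set (ℂ × ℂ)) = ⊤ := by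
    have h := Submodule.map_span ((A : ℂ × ℂ →ₗ[ℂ] ℂ × ℂ).restrictScalars ℝ) (D : Set (ℂ × ℂ))
    rw [hD, Submodule.map_top] at h
    exact h.symm.trans (LinearMap.range_eq_top.2 A.surjective)
  exact (hL.prod hL).exists_zsmul_mem hmap hspan

/-- The lattice `L` has a non-real multiplier. With `A = wedgeEquiv a b` and `d = wedge a b`, the
form `wedge` becomes the determinant divided by `d`, so that its values on the vectors
`A⁻¹ (n l, 0)` and `A⁻¹ (0, n m)` of `D` show that `n² l m / d ∈ L` for all `l`, `m` in `L`. -/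
theorem exists_im_ne_zero_mem_multiplierRing {D : AddSubgroup (ℂ × ℂ)} {L : AddSubgroup ℂ}
    (hD : Submodule.span ℝ (D : Set (ℂ × ℂ)) = ⊤) (hDL : ∀ v ∈ D, ∀ w ∈ D, wedge v w ∈ L)
    (hL : IsLattice L) :
    ∃ κ ∈ multiplierRing L, κ.im ≠ 0 := by
  obtain ⟨a, ha, b, hb, hab⟩ := exists_wedge_ne_zero hD
  obtain ⟨n, hn, h⟩ := exists_zsmul_mem_map_wedgeEquiv hD hDL hL ha hb hab
  have hnC : (n : ℂ) ≠ 0 := mod_cast hn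
  have hmul : ∀ l ∈ L, (n : ℂ) ^ 2 * l / wedge a b ∈ multiplierRing L := by
    intro l hl m hm
    obtain ⟨v, hv, hv'⟩ := h (l, 0) ⟨hl, L.zero_mem⟩
    obtain ⟨w, hw, hw'⟩ := h (0, m) ⟨L.zero_mem, hm⟩
    have e1 : wedge v a = n * l := by simpa [wedgeEquiv_apply] using congrArg Prod.fst hv'
    have e2 : wedge v b = 0 := by simpa [wedgeEquiv_apply] using congrArg Prod.snd hv'
    have e3 : wedge w a = 0 := by simpa [wedgeEquiv_apply] using congrArg Prod.fst hw'
    have e4 : wedge w b = n * m := by simpa [wedgeEquiv_apply] using congrArg Prod.snd hw'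
    have e5 : (n : ℂ) ^ 2 * l / wedge a b * m = wedge v w := by
      -- The Plücker relation
      have e6 : wedge v w * wedge a b = wedge v a * wedge w b - wedge v b * wedge w a := by
        simp only [wedge]
        ring
      rw [e1, e2, e3, e4] at e6
      field_simp
      linear_combination -e6
    rw [e5]
    exact hDL v hv w hw
  by_contra! hreal
  -- otherwise `L` lies on the real line through `wedge a b`
  have hsub : (L : Set ℂ) ⊆ Submodule.span ℝ {wedge a b} := by
    intro l hl
    have him := hreal _ (hmul l hl)
    rw [SetLike.mem_coe, Submodule.mem_span_singleton]
    refine ⟨((n : ℂ) ^ 2 * l / wedge a b).re / (n : ℝ) ^ 2, ?_⟩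
    have e : ((((n : ℂ) ^ 2 * l / wedge a b).re : ℝ) : ℂ) = (n : ℂ) ^ 2 * l / wedge a b :=
      Complex.ext (by simp) (by simp [him])
    rw [Complex.real_smul]
    push_cast
    rw [e]
    field_simp
  have hle := Submodule.span_le.2 hsub
  rw [hL.2] at hle
  have hfin := finrank_span_singleton (K := ℝ) hab
  rw [top_le_iff.1 hle, finrank_top, Complex.finrank_real_complex] at hfin
  norm_num at hfin

/-- The torus `ℂ² ⧸ D` is isogenous to the square of `ℂ ⧸ L`, by the map that `wedgeEquiv a b`
induces for a basis `a`, `b` of `ℂ²` contained in `D`. -/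
theorem isogenous_prod_self {D : AddSubgroup (ℂ × ℂ)} {L : AddSubgroup ℂ}
    (hD : Submodule.span ℝ (D : Set (ℂ × ℂ)) = ⊤) (hDL : ∀ v ∈ D, ∀ w ∈ D, wedge v w ∈ L)
    (hL : IsLattice L) : Isogenous D (L.prod L) := by
  obtain ⟨a, ha, b, hb, hab⟩ := exists_wedge_ne_zero hD
  obtain ⟨n, hn, h⟩ := exists_zsmul_mem_map_wedgeEquiv hD hDL hL ha hb hab
  let A := wedgeEquiv a b hab
  have hA : ∀ v ∈ D, A v ∈ L.prod L := fun v hv => by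
    rw [wedgeEquiv_apply]
    exact ⟨hDL v hv a ha, hDL v hv b hb⟩
  let f : (ℂ × ℂ) ⧸ D →+ (ℂ × ℂ) ⧸ L.prod L :=
    QuotientAddGroup.map D (L.prod L) (A : ℂ × ℂ →+ ℂ × ℂ) hA
  have hf (u : ℂ × ℂ) : f (QuotientAddGroup.mk u) = QuotientAddGroup.mk (A u) := rfl
  refine ⟨f, fun v => ⟨A, ?_, Filter.Eventually.of_forall hf⟩, fun t => ?_, ?_⟩
  · exact (LinearMap.toContinuousLinearMap (A : ℂ × ℂ →ₗ[ℂ] ℂ × ℂ)).analyticAt v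
  · induction t using QuotientAddGroup.induction_on with | _ u
    exact ⟨QuotientAddGroup.mk (A.symm u), by rw [hf, A.apply_symm_apply]⟩
  · -- the kernel is the image of `L × L` under `A⁻¹`: finitely generated, and killed by `n`
    let g : L.prod L →+ (ℂ × ℂ) ⧸ D :=
      ((QuotientAddGroup.mk' D).comp (A.symm : ℂ × ℂ →+ ℂ × ℂ)).comp (L.prod L).subtype
    have hg (p : L.prod L) : g p = QuotientAddGroup.mk (A.symm p) := rfl
    have := (hL.prod hL).module_finite
    have : AddGroup.FG (L.prod L) := Module.Finite.iff_addGroup_fg.1 this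
    have htors : IsAddTorsion g.range := by
      rintro ⟨_, p, rfl⟩
      rw [isOfFinAddOrder_iff_zsmul_eq_zero]
      refine ⟨n, hn, Subtype.ext ?_⟩
      obtain ⟨v, hv, hvp⟩ := h p p.2
      change n • g p = 0
      rw [hg, ← QuotientAddGroup.mk_zsmul, ← map_zsmul, ← hvp]
      exact (QuotientAddGroup.eq_zero_iff _).2 (by rwa [LinearEquiv.symm_apply_apply])
    have : Finite g.range := AddCommGroup.finite_of_fg_isAddTorsion _ htors
    refine (Set.toFinite (g.range : Set ((ℂ × ℂ) ⧸ D))).subset fun t ht => ?_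
    induction t using QuotientAddGroup.induction_on with | _ u
    have hu : A u ∈ L.prod L := (QuotientAddGroup.eq_zero_iff _).1 ht
    exact ⟨⟨A u, hu⟩, by rw [hg, A.symm_apply_apply]⟩

/-! ### The stabilizer of a point of an Iwasawa manifold -/

namespace G

/-- The coordinates of `G` as a homeomorphism onto `ℂ³`. -/
noncomputable def coordHomeomorph : G ≃ₜ ℂ × ℂ × ℂ :=
  Equiv.toHomeomorphOfIsInducing
    { toFun := fun g => (g.x, g.y, g.z)
      invFun := fun q => ⟨q.1, q.2.1, q.2.2⟩
      left_inv := fun _ => rfl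
      right_inv := fun _ => rfl } ⟨rfl⟩

theorem continuous_coords : Continuous fun g : G => (g.x, g.y, g.z) :=
  coordHomeomorph.continuous

theorem continuous_x : Continuous G.x := continuous_coords.fst

theorem continuous_y : Continuous G.y := continuous_coords.snd.fst

theorem continuous_z : Continuous G.z := continuous_coords.snd.snd

theorem continuous_iff {X : Type*} [TopologicalSpace X] {f : X → G} : Continuous f ↔
    Continuous fun t => ((f t).x, (f t).y, (f t).z) :=
  continuous_induced_rng

instance : IsTopologicalGroup G where
  continuous_mul := by
    have := continuous_x
    have := continuous_y
    have := continuous_z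
    rw [continuous_iff]
    simp only [mul_x, mul_y, mul_z]
    fun_prop
  continuous_inv := by
    have := continuous_x
    have := continuous_y
    have := continuous_z
    rw [continuous_iff]
    simp only [inv_x, inv_y, inv_z]
    fun_prop

instance : SigmaCompactSpace G :=
  coordHomeomorph.isClosedEmbedding.sigmaCompactSpace

end G

/-- The commutator of two elements of the stabilizer is central, with coordinate the alternating
form of their images in `ℂ²`. -/
theorem wedge_mem_fibreLattice {I : Type*} [MulAction G I] (o : I) {v w : ℂ × ℂ}
    (hv : v ∈ baseLattice o) (hw : w ∈ baseLattice o) : wedge v w ∈ fibreLattice o := by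
  obtain ⟨g, hg, rfl⟩ := (mem_baseLattice o _).1 hv
  obtain ⟨h, hh, rfl⟩ := (mem_baseLattice o _).1 hw
  have e : (⟨0, wedge (g.x, g.z) (h.x, h.z), 0⟩ : G) = g * h * g⁻¹ * h⁻¹ := by
    ext
    · simp
    · simp [wedge]
      ring
    · simp
  rw [mem_fibreLattice, e]
  have hg' : g⁻¹ • o = o := by rw [inv_smul_eq_iff, hg]
  have hh' : h⁻¹ • o = o := by rw [inv_smul_eq_iff, hh]
  simp only [mul_smul, hg, hh, hg', hh']

section

variable (F : Type*) [NormedAddCommGroup F] [NormedSpace ℂ F]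
    {I : Type*} [TopologicalSpace I] [ChartedSpace F I] [MulAction G I]

theorem IwasawaManifold.continuousSMul [h : IwasawaManifold F I] : ContinuousSMul G I where
  continuous_smul := by
    exact h.holomorphic_action.continuous.comp
      ((G.continuous_coords.comp continuous_fst).prodMk continuous_snd)

/-- The stabilizer of `o` is cocompact: every `g` has the same orbit point as an `h` with bounded
coordinates. By the open mapping theorem for transitive actions of `σ`-compact groups, the images
of the balls of `G` are open in the compact space `I`. -/
theorem IwasawaManifold.exists_bounded_smul_eq [h : IwasawaManifold F I] (o : I) :
    ∃ R : ℝ, ∀ g : G, ∃ k : G, ‖(k.x, k.z)‖ ≤ R ∧ k • o = g • o := by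
  have := h.t2Space
  have := h.compactSpace
  have := h.transitive
  have := IwasawaManifold.continuousSMul F (I := I)
  have hopen := isOpenMap_smul_of_sigmaCompact (G := G) o
  have hxz : Continuous fun g : G => ‖(g.x, g.z)‖ := (G.continuous_x.prodMk G.continuous_z).norm
  let U : ℕ → Set I := fun n => (fun g : G => g • o) '' {g | ‖(g.x, g.z)‖ < n}
  have hU : ∀ n, IsOpen (U n) := fun n => hopen _ (isOpen_lt hxz continuous_const)
  have hcover : (Set.univ : Set I) ⊆ ⋃ n, U n := by
    intro p _
    obtain ⟨g, rfl⟩ := MulAction.exists_smul_eq G o p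
    obtain ⟨n, hn⟩ := exists_nat_gt ‖(g.x, g.z)‖
    exact Set.mem_iUnion.2 ⟨n, g, hn, rfl⟩
  have hmono : Monotone U := fun m n hmn => Set.image_mono fun g hg =>
    lt_of_lt_of_le (show ‖(g.x, g.z)‖ < m from hg) (mod_cast hmn)
  obtain ⟨n, hn⟩ := isCompact_univ.elim_directed_cover U hU hcover hmono.directed_le
  refine ⟨n, fun g => ?_⟩
  obtain ⟨k, hk, e⟩ := hn (Set.mem_univ (g • o))
  exact ⟨k, le_of_lt hk, e⟩

theorem span_baseLattice_eq_top [IwasawaManifold F I] (o : I) :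
    Submodule.span ℝ (baseLattice o : Set (ℂ × ℂ)) = ⊤ := by
  obtain ⟨R, hR⟩ := IwasawaManifold.exists_bounded_smul_eq F o
  refine span_eq_top_of_cobounded (R := R) fun v => ?_
  obtain ⟨k, hk, e⟩ := hR ⟨v.1, 0, v.2⟩
  refine ⟨(k.x, k.z), hk, Submodule.subset_span ((mem_baseLattice o _).2
    ⟨k⁻¹ * ⟨v.1, 0, v.2⟩, ?_, ?_⟩)⟩
  · rw [mul_smul, ← e, inv_smul_smul]
  · ext <;> simp [sub_eq_neg_add]

theorem discreteTopology_fibreLattice [h : IwasawaManifold F I] (o : I) :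
    DiscreteTopology (fibreLattice o) := by
  have := h.discrete_stabilizer o
  let f : fibreLattice o → MulAction.stabilizer G o := fun w => ⟨⟨0, w, 0⟩, w.2⟩
  refine DiscreteTopology.of_continuous_injective (f := f) ?_ fun v w hvw => ?_
  · refine Continuous.subtype_mk ?_ _
    rw [G.continuous_iff]
    fun_prop
  · exact Subtype.ext (congrArg (fun g : MulAction.stabilizer G o => g.1.y) hvw)

theorem isLattice_fibreLattice [IwasawaManifold F I] (o : I) : IsLattice (fibreLattice o) :=
  ⟨discreteTopology_fibreLattice F o, span_wedge_eq_top (span_baseLattice_eq_top F o)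
    fun _ hv _ hw => Submodule.subset_span (wedge_mem_fibreLattice o hv hw)⟩

end

end Iwasawa

theorem corollary6p5 {F : Type*} [NormedAddCommGroup F] [NormedSpace ℂ F]
    {I : Type*} [TopologicalSpace I] [ChartedSpace F I] [MulAction Iwasawa.G I]
    [Iwasawa.IwasawaManifold F I] (o : I) :
    -- the fibre `E` is an elliptic curve and the base `T` is a complex torus
    Iwasawa.IsLattice (Iwasawa.fibreLattice o) ∧ Iwasawa.IsLattice (Iwasawa.baseLattice o) ∧
      ∃ L' L'' : AddSubgroup ℂ, Iwasawa.IsLattice L' ∧ Iwasawa.IsLattice L'' ∧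
        Iwasawa.Isogenous (Iwasawa.baseLattice o) (L'.prod L'') ∧
        ∃ (K : Type) (_ : Field K) (_ : NumberField K), Iwasawa.IsImaginaryQuadratic K ∧
          Iwasawa.HasCMBy (Iwasawa.fibreLattice o) K ∧ Iwasawa.HasCMBy L' K ∧ Iwasawa.HasCMBy L'' K := by
  have hD := Iwasawa.span_baseLattice_eq_top F o
  have hDL : ∀ v ∈ Iwasawa.baseLattice o, ∀ w ∈ Iwasawa.baseLattice o,
      Iwasawa.wedge v w ∈ Iwasawa.fibreLattice o :=
    fun _ hv _ hw => Iwasawa.wedge_mem_fibreLattice o hv hw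
  have hL := Iwasawa.isLattice_fibreLattice F o
  obtain ⟨κ, hκ, him⟩ := Iwasawa.exists_im_ne_zero_mem_multiplierRing hD hDL hL
  obtain ⟨K, hfield, hnum, hquad, hCM⟩ := hL.exists_hasCMBy hκ him
  exact ⟨hL, ⟨Iwasawa.discreteTopology_of_wedge_mem hD hDL hL.1, hD⟩,
    Iwasawa.fibreLattice o, Iwasawa.fibreLattice o, hL, hL,
    Iwasawa.isogenous_prod_self hD hDL hL, K, hfield, hnum, hquad, hCM, hCM, hCM⟩
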